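/- Let $\mathbb{N}^{\mathbb{N}}$ be Baire space, represented by the identity. Let $(U_n)_{n\in\mathbb{N}}$ be a standard enumeration of the c.e. open subsets of $\mathbb{N}^{\mathbb{N}}$, and let $J:\mathbb{N}^{\mathbb{N}}\to\mathbb{N}^{\mathbb{N}}$ be the (injective) Turing jump operator, $J(p)(n)=1$ if $p\in U_n$ and $J(p)(n)=0$ otherwise. Let $\lim:\subseteq\mathbb{N}^{\mathbb{N}}\to\mathbb{N}^{\mathbb{N}}$, $\langle p_0,p_1,p_2,\dots\rangle\mapsto\lim_{i\to\infty}p_i$, be the limit map of Baire space, and let $\mathfrak{L}:=J^{-1}\circ\lim:\subseteq\mathbb{N}^{\mathbb{N}}\to\mathbb{N}^{\mathbb{N}}$, with its natural domain. For multi-valued functions $f:\subseteq X\rightrightarrows Y$ and $g:\subseteq U\rightrightarrows V$ between represented spaces, $f\leq_{W} g$ means that there are computable $K,H:\subseteq\mathbb{N}^{\mathbb{N}}\to\mathbb{N}^{\mathbb{N}}$ such that $K\circ\langle\mathrm{id},G\circ H\rangle$ is a realizer of $f$ for every realizer $G$ of $g$. Further, $f<_{W}g$ means $f\leq_W g$ and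 $g\not\leq_W f$, and $f\equiv_W g$ means $f\leq_W g$ and $g\leq_W f$. Products $f\times g$, $(f\times g)(x,w)=f(x)\times g(w)$, are taken with respect to the product representations. Theorem. $\mathfrak{L}<_{W}\mathfrak{L}\times\mathfrak{L}$. In particular, $\mathfrak{L}$ is not idempotent, i.e. $\mathfrak{L}\times\mathfrak{L}\not\equiv_{W}\mathfrak{L}$. -/

import Mathlib

open Filter Topology

/-- Baire space; as a topological space it carries the product of the discrete topologies. -/
abbrev Baire : Type := ℕ → ℕ

namespace Baire

/-- The word `p(0) p(1) ... p(n-1)`. -/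
def word (p : Baire) (n : ℕ) : List ℕ := (List.range n).map p

/-- The pairing of two sequences: `⟨p, q⟩ (2 n) = p n` and `⟨p, q⟩ (2 n + 1) = q n`. -/
def pair (p q : Baire) : Baire := fun n => if n % 2 = 0 then p (n / 2) else q (n / 2)

/-- The two components of a sequence with respect to the bijective pairing `Baire.pair`. -/
def left (r : Baire) : Baire := fun n => r (2 * n)

def right (r : Baire) : Baire := fun n => r (2 * n + 1)

theorem left_pair (p q : Baire) : left (pair p q) = p := by
  funext n; simp [left, pair]

theorem right_pair (p q : Baire) : right (pair p q) = q := by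
  funext n
  have h1 : (2 * n + 1) % 2 = 1 := by omega
  have h2 : (2 * n + 1) / 2 = n := by omega
  simp [right, pair, h1, h2]

theorem pair_left_right (r : Baire) : pair (left r) (right r) = r := by
  funext n
  rcases Nat.mod_two_eq_zero_or_one n with h | h
  · have h2 : 2 * (n / 2) = n := by omega
    simp [left, pair, h, h2]
  · have h2 : 2 * (n / 2) + 1 = n := by omega
    simp [right, pair, h, h2]

/-- The `i`-th component `p_i` of `p = ⟨p_0, p_1, p_2, ...⟩`, where
`⟨p_0, p_1, p_2, ...⟩ (⟨i, j⟩) = p_i j`. -/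
def component (p : Baire) (i : ℕ) : Baire := fun j => p (Nat.pair i j)

end Baire

/-- A partial function `F` on Baire space is computable if some Type-2 machine transforms every
`p` in the domain of `F` into `F p`. The machine is given by the computable function `φ` on words
that is monotone for the prefix order: `φ w` is what the machine can write on its one-way output
tape having read the word `w`, and the output on the input `p` is the supremum of the words
`φ (p(0) ... p(n-1))`. As usual the behaviour of the machine outside the domain of `F` is not
restricted. -/
def BaireComputable (F : Baire →. Baire) : Prop :=
  ∃ φ : List ℕ → List ℕ, Computable φ ∧ (∀ u v : List ℕ, u <+: v → φ u <+: φ v) ∧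
    ∀ p q : Baire, q ∈ F p → ∀ k : ℕ, ∃ n : ℕ, q.word k <+: φ (p.word n)

/-- A represented space: a set with a surjective partial function from Baire space onto it. -/
class RepresentedSpace (X : Type*) where
  rep : Baire →. X
  surjective : ∀ x : X, ∃ p : Baire, x ∈ rep p

/-- Baire space is represented by the identity. -/
instance Baire.instRepresentedSpace : RepresentedSpace Baire where
  rep := PFun.id Baire
  surjective := fun p => ⟨p, by simp⟩

/-- The product representation: `⟨p, q⟩` is a name of `(x, y)` if and only if `p` is a name of `x`
and `q` is a name of `y`. -/
instance Prod.instRepresentedSpace (X Y : Type*) [RepresentedSpace X] [RepresentedSpace Y] :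
    RepresentedSpace (X × Y) where
  rep := fun r => (RepresentedSpace.rep (X := X) r.left).bind fun x =>
    (RepresentedSpace.rep (X := Y) r.right).map fun y => (x, y)
  surjective := by
    rintro ⟨x, y⟩
    obtain ⟨p, hp⟩ := RepresentedSpace.surjective x
    obtain ⟨q, hq⟩ := RepresentedSpace.surjective y
    refine ⟨Baire.pair p q, ?_⟩
    rw [Baire.left_pair, Baire.right_pair]
    exact Part.mem_bind hp (Part.mem_map _ hq)

/-- Partial multi-valued functions `f :⊆ X ⇉ Y`; the domain of `f` is the set of all `x` such that
`f x` is non-empty. -/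
def MultiFun (X Y : Type*) : Type _ := X → Set Y

namespace MultiFun

/-- The domain of a multi-valued function. -/
def dom {X Y : Type*} (f : MultiFun X Y) : Set X := {x | (f x).Nonempty}

/-- Composition `g ∘ f` of multi-valued functions: `x` is in the domain if and only if it is in the
domain of `f` and all of `f x` lies in the domain of `g`. -/
def comp {X Y Z : Type*} (g : MultiFun Y Z) (f : MultiFun X Y) : MultiFun X Z :=
  fun x => {z | f x ⊆ g.dom ∧ ∃ y ∈ f x, z ∈ g y}

/-- The product `f × g`, with `(f × g)(x, w) = f x × g w`. -/
def prod {X Y W Z : Type*} (f : MultiFun X Y) (g : MultiFun W Z) : MultiFun (X × W) (Y × Z) :=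
  fun x => f x.1 ×ˢ g x.2

end MultiFun

section Weihrauch

variable {X Y U V : Type*} [RepresentedSpace X] [RepresentedSpace Y]
  [RepresentedSpace U] [RepresentedSpace V]

/-- `F` is a realizer of `f`: for every name `p` of a point `x` in the domain of `f`,
the value `F p` is defined and is a name of a point of `f x`. -/
def Realizes (F : Baire →. Baire) (f : MultiFun X Y) : Prop :=
  ∀ (p : Baire) (x : X), x ∈ RepresentedSpace.rep p → x ∈ f.dom →
    ∃ q ∈ F p, ∃ y ∈ RepresentedSpace.rep (X := Y) q, y ∈ f x

/-- Weihrauch reducibility `f ≤_W g`: there are computable `K` and `H` such that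
`K ∘ ⟨id, G ∘ H⟩` is a realizer of `f` for every realizer `G` of `g`. -/
def WeihrauchReducible (f : MultiFun X Y) (g : MultiFun U V) : Prop :=
  ∃ K H : Baire →. Baire, BaireComputable K ∧ BaireComputable H ∧
    ∀ G : Baire →. Baire, Realizes G g →
      Realizes (K.comp fun p => ((G.comp H) p).map fun q => Baire.pair p q) f

/-- Weihrauch equivalence. -/
def WeihrauchEquivalent (f : MultiFun X Y) (g : MultiFun U V) : Prop :=
  WeihrauchReducible f g ∧ WeihrauchReducible g f

/-- Strict Weihrauch reducibility `f <_W g`. -/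
def StrictlyWeihrauchReducible (f : MultiFun X Y) (g : MultiFun U V) : Prop :=
  WeihrauchReducible f g ∧ ¬ WeihrauchReducible g f

/-- `f` is idempotent if `f × f ≡_W f`. -/
def WeihrauchIdempotent (f : MultiFun X Y) : Prop :=
  WeihrauchEquivalent (f.prod f) f

end Weihrauch

/-- The standard enumeration of the c.e. open subsets of Baire space: `U_n` is the union of the
balls `w ℕ^ℕ` over all words `w` in the domain of the `n`-th partial recursive function. -/
def ceOpen (n : ℕ) : Set Baire :=
  {p | ∃ k : ℕ, ((Denumerable.ofNat Nat.Partrec.Code n).eval (Encodable.encode (p.word k))).Dom}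

open Classical in
/-- The Turing jump operator: `J p n = 1` if `p ∈ U_n`, and `J p n = 0` otherwise. -/
noncomputable def turingJump (p : Baire) : Baire := fun n => if p ∈ ceOpen n then 1 else 0

/-- The inverse of the (injective) Turing jump operator; its domain is the range of `J`. -/
def turingJumpInv : MultiFun Baire Baire := fun r => {q | turingJump q = r}

/-- The limit map `⟨p_0, p_1, p_2, ...⟩ ↦ lim p_i` of Baire space. -/
def limMap : MultiFun Baire Baire := fun p => {q | Tendsto p.component atTop (𝓝 q)}

/-- The low map `L = J⁻¹ ∘ lim`. -/
def lowMap : MultiFun Baire Baire := turingJumpInv.comp limMap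

open Nat.Partrec (Code)
open Nat.Partrec.Code (eval evaln)
open Denumerable (ofNat ofNat_encode)
open Encodable (encode)

/-! On computable inputs, values of `lowMap` are low: their jump is a computable limit. Lowness is
not preserved by pairing, and this separates `lowMap` from its square. Finite extension builds low
`p` and `q` whose pair computes the halting problem (`exists_low_pair`). Each stage forces the next
jump bit of both points. Each point records where to look in the other, and `p` also records whether
the `e`-th c.e. open set is empty. A reduction of the product to `lowMap` would turn computable
names of `p` and `q` into a computable `z`, and `r = lowMap z` would compute the pair. So `r` could
enumerate the indices of empty c.e. open sets. By the recursion theorem no low point can do so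
(`not_enumerates_empty`): it could confirm that the approximation to a jump bit of its own has
settled at 0, and then falsify that bit. -/

theorem List.IsPrefix.getElem?_eq_some_of {α : Type*} {u v : List α} (h : u <+: v) {i : ℕ} {a : α}
    (ha : u[i]? = some a) : v[i]? = some a := by
  obtain ⟨hi, rfl⟩ := List.getElem?_eq_some_iff.1 ha
  exact List.prefix_iff_getElem?.1 h i hi

/-! ### Finite words and Type-2 machines -/

namespace Baire

@[simp] theorem getElem_word (p : Baire) (n i : ℕ) (h : i < (p.word n).length) :
    (p.word n)[i] = p i := by simp [word]

@[simp] theorem length_word (p : Baire) (n : ℕ) : (p.word n).length = n := by simp [word]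

theorem getElem?_word (p : Baire) (n i : ℕ) : (p.word n)[i]? = if i < n then some (p i) else none := by
  by_cases h : i < n <;> simp [word, h]

theorem word_prefix_iff {p : Baire} {k : ℕ} {u : List ℕ} :
    p.word k <+: u ↔ ∀ i < k, u[i]? = some (p i) := by
  rw [List.prefix_iff_getElem?]
  simp [word]

theorem word_prefix_word (p : Baire) {m n : ℕ} (h : m ≤ n) : p.word m <+: p.word n :=
  word_prefix_iff.2 fun i hi => by simp [hi.trans_le h]

theorem take_word (p : Baire) (m n : ℕ) : (p.word n).take m = p.word (min m n) := by
  rw [word, ← List.map_take, List.take_range, word]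

end Baire

open Baire

/-- The output of a machine computing `F` on input `p` with `q ∈ F p` is correct at each stage. -/
theorem BaireComputable.getElem?_eq {φ : List ℕ → List ℕ} (hmono : ∀ u v, u <+: v → φ u <+: φ v)
    {p q : Baire} (hq : ∀ k, ∃ n, q.word k <+: φ (p.word n)) {n i a : ℕ}
    (h : (φ (p.word n))[i]? = some a) : a = q i := by
  obtain ⟨m, hm⟩ := hq (i + 1)
  have h1 := word_prefix_iff.1 (hm.trans (hmono _ _ (p.word_prefix_word (le_max_left m n)))) i
    (Nat.lt_succ_self i)
  have h2 := (hmono _ _ (p.word_prefix_word (le_max_right m n)))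
  have h3 := List.IsPrefix.getElem?_eq_some_of h2 h
  rw [h1] at h3
  exact (Option.some.inj h3).symm

theorem Computable.baire_word {p : Baire} (hp : Computable p) : Computable p.word := by
  refine (Computable.nat_rec (f := fun n : ℕ => n) (g := fun _ => ([] : List ℕ))
    (h := fun _ x => x.2 ++ [p x.1]) Computable.id (Computable.const _) ?_).of_eq fun n => ?_
  · exact (Computable.list_concat.comp (Computable.snd.comp Computable.snd)
      (hp.comp (Computable.fst.comp Computable.snd))).to₂
  · induction n with
    | zero => rfl
    | succ n ih => simp_all [Baire.word, List.range_succ]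

theorem BaireComputable.computable {F : Baire →. Baire} (hF : BaireComputable F) {p q : Baire}
    (hp : Computable p) (hq : q ∈ F p) : Computable q := by
  obtain ⟨φ, hφ, hmono, hout⟩ := hF
  have key := hout p q hq
  have : Partrec fun i : ℕ => Nat.rfindOpt fun n => (φ (p.word n))[i]? :=
    Partrec.rfindOpt (Computable.list_getElem?.comp
      (hφ.comp (hp.baire_word.comp Computable.snd)) Computable.fst).to₂
  refine this.of_eq_tot fun i => ?_
  rw [Nat.rfindOpt_mono]
  · obtain ⟨n, hn⟩ := key (i + 1)
    exact ⟨n, word_prefix_iff.1 hn i (Nat.lt_succ_self i)⟩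
  · intro a m n hmn ha
    exact List.IsPrefix.getElem?_eq_some_of (hmono _ _ (p.word_prefix_word hmn)) ha

/-- Reindexing along a computable function of linear growth is computable. -/
theorem baireComputable_reindex {g : ℕ → ℕ} (hg : Primrec g) (c : ℕ)
    (hc : ∀ i, g i < c * (i + 1)) : BaireComputable ((fun p : Baire => p ∘ g : Baire → Baire) : Baire →. Baire) := by
  -- For `i < w.length / c` the bound `hc` puts `g i` inside `w`, so the default 0 is never output
  -- and the machine is monotone.
  refine ⟨fun w => (List.range (w.length / c)).map fun i => w.getD (g i) 0, ?_, ?_, ?_⟩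
  · refine Primrec.to_comp (Primrec.list_map (Primrec.list_range.comp
      (Primrec.nat_div.comp Primrec.list_length (Primrec.const c))) ?_)
    exact ((Primrec.list_getD 0).comp Primrec.fst (hg.comp Primrec.snd)).to₂
  · intro u v huv
    have hlen : u.length / c ≤ v.length / c := Nat.div_le_div_right huv.length_le
    rw [List.prefix_iff_getElem?]
    intro i hi
    simp only [List.length_map, List.length_range] at hi
    have hgi : g i < u.length :=
      (hc i).trans_le ((Nat.mul_le_mul_left c hi).trans (Nat.mul_div_le _ _))
    have := List.IsPrefix.getElem?_eq_some_of huv (List.getElem?_eq_getElem hgi)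
    simp [hi.trans_le hlen, this, hgi]
  · intro p q hq k
    obtain rfl : p ∘ g = q := by simpa [eq_comm] using hq
    have hc0 : 0 < c := Nat.pos_of_ne_zero fun h => by simpa [h] using hc 0
    refine ⟨c * k, word_prefix_iff.2 fun i hi => ?_⟩
    have hgi : g i < c * k := (hc i).trans_le (Nat.mul_le_mul_left c hi)
    simp [hc0, hi, getElem?_word, hgi]

/-! ### The jump and the low map -/

theorem mem_ceOpen {p : Baire} {n : ℕ} :
    p ∈ ceOpen n ↔ ∃ k, (eval (ofNat Code n) (encode (p.word k))).Dom := Iff.rfl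

theorem turingJump_eq_one {p : Baire} {n : ℕ} : turingJump p n = 1 ↔ p ∈ ceOpen n := by
  simp [turingJump]

theorem turingJump_eq_zero {p : Baire} {n : ℕ} : turingJump p n = 0 ↔ p ∉ ceOpen n := by
  simp [turingJump]

theorem Partrec.exists_code {f : ℕ → Option ℕ} (hf : Computable f) :
    ∃ c : Code, ∀ x, eval c x = (f x : Part ℕ) := by
  obtain ⟨c, hc⟩ := Nat.Partrec.Code.exists_code.1 (Partrec.nat_iff.1 hf.ofOption)
  exact ⟨c, fun x => by rw [hc]⟩

/-- Each set `{r | r i = p i}` is c.e. open, so the jump determines every entry. -/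
theorem turingJump_injective : Function.Injective turingJump := by
  intro p q h
  funext i
  have hf : Computable fun x : ℕ =>
      ((ofNat (List ℕ) x)[i]?).bind fun a => if a = p i then some 0 else none := by
    refine Primrec.to_comp (Primrec.option_bind
      (Primrec.list_getElem?.comp (Primrec.ofNat _) (Primrec.const i)) ?_)
    exact (Primrec.ite (Primrec.eq.comp Primrec.snd (Primrec.const (p i))) (Primrec.const _)
      (Primrec.const _)).to₂
  obtain ⟨c, hc⟩ := Partrec.exists_code hf
  have key : ∀ r : Baire, r ∈ ceOpen (encode c) ↔ r i = p i := by
    intro r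
    simp only [mem_ceOpen, ofNat_encode, hc]
    constructor
    · rintro ⟨k, hk⟩
      by_contra hne
      by_cases hik : i < k <;> simp_all
    · intro hr
      exact ⟨i + 1, by simp [hr]⟩
  have h1 := congrFun h (encode c)
  have h2 := turingJump_eq_one.2 ((key p).2 rfl)
  exact ((key q).1 (turingJump_eq_one.1 (h1 ▸ h2))).symm

/-- Limits in Baire space are unique, so the domain condition of the composition is automatic. -/
theorem mem_lowMap {x q : Baire} :
    q ∈ lowMap x ↔ ∀ e, ∀ᶠ t in atTop, x (Nat.pair t e) = turingJump q e := by
  have hlim : ∀ y : Baire, y ∈ limMap x ↔ ∀ e, ∀ᶠ t in atTop, x (Nat.pair t e) = y e := by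
    intro y
    simp [limMap, tendsto_pi_nhds, nhds_discrete, Baire.component]
  rw [← hlim]
  constructor
  · rintro ⟨-, y, hy, hq⟩
    have : turingJump q = y := hq
    rwa [this]
  · intro h
    refine ⟨fun y hy => ⟨q, ?_⟩, turingJump q, h, rfl⟩
    exact tendsto_nhds_unique h hy

theorem lowMap_subsingleton {x p q : Baire} (hp : p ∈ lowMap x) (hq : q ∈ lowMap x) : p = q := by
  apply turingJump_injective
  funext e
  obtain ⟨t, h1, h2⟩ := ((mem_lowMap.1 hp e).and (mem_lowMap.1 hq e)).exists
  exact h1.symm.trans h2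

theorem mem_rep_prod {p x y : Baire} :
    (x, y) ∈ RepresentedSpace.rep (X := Baire × Baire) p ↔ x = p.left ∧ y = p.right := by
  simp [RepresentedSpace.rep]

theorem mem_rep {p x : Baire} : x ∈ RepresentedSpace.rep (X := Baire) p ↔ x = p := by
  simp [RepresentedSpace.rep, eq_comm]

theorem lowMap_le_prod : WeihrauchReducible lowMap (lowMap.prod lowMap) := by
  -- `n / 2` duplicates the input; `4 * n + 1` reads the left half of the right half of `⟨x, r⟩`.
  refine ⟨_, _, baireComputable_reindex (g := fun n => 4 * n + 1) ?_ 4 (by omega),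
    baireComputable_reindex (g := fun n => n / 2) ?_ 1 (by omega), ?_⟩
  · exact Primrec.succ.comp (Primrec.nat_mul.comp (Primrec.const 4) Primrec.id)
  · exact Primrec.nat_div.comp Primrec.id (Primrec.const 2)
  intro G hG p x hx hdom
  obtain rfl := mem_rep.1 hx
  obtain ⟨q, hq⟩ := hdom
  have hpp : (x ∘ fun n => n / 2) = pair x x := by
    funext n; simp [pair]
  obtain ⟨r, hr, ⟨y1, y2⟩, hy, hy1, hy2⟩ := hG (pair x x) (x, x)
    (mem_rep_prod.2 ⟨(left_pair _ _).symm, (right_pair _ _).symm⟩) ⟨(q, q), hq, hq⟩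
  obtain ⟨rfl, rfl⟩ := mem_rep_prod.1 hy
  refine ⟨r.left, ?_, r.left, mem_rep.2 rfl, hy1⟩
  have hcomp : (pair x r ∘ fun n => 4 * n + 1) = r.left := by
    have h : (pair x r).right.left = r.left := by rw [right_pair]
    rw [← h]
    funext n
    simp only [Function.comp, right, left]
    congr 1
    ring
  refine Part.mem_bind (a := pair x r) ?_ (by simp [hcomp])
  exact Part.mem_map _ (Part.mem_bind (a := pair x x) (by simp [hpp]) hr)

/-! ### Sequences extending finite words -/

/-- `p` extends the word `w`. -/
def Baire.Extends (p : Baire) (w : List ℕ) : Prop := p.word w.length = w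

namespace Baire

theorem Extends.mono {p : Baire} {u v : List ℕ} (h : p.Extends v) (huv : u <+: v) :
    p.Extends u := by
  have h1 : p.word u.length <+: v := h ▸ p.word_prefix_word huv.length_le
  exact (List.prefix_of_prefix_length_le h1 huv (by simp)).eq_of_length (by simp)

theorem Extends.apply_length {p : Baire} {w : List ℕ} {a : ℕ} (h : p.Extends (w ++ [a])) :
    p w.length = a := by
  have h1 : (p.word (w ++ [a]).length)[w.length]? = (w ++ [a])[w.length]? := by rw [h]
  simpa [getElem?_word] using h1

theorem Extends.word_eq_append {p : Baire} {w : List ℕ} (h : p.Extends w) {n : ℕ}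
    (hn : w.length ≤ n) : ∃ v, p.word n = w ++ v := by
  have h1 : w <+: p.word n := by
    have := p.word_prefix_word hn
    rwa [h] at this
  obtain ⟨v, hv⟩ := h1
  exact ⟨v, hv.symm⟩

theorem exists_extends_of_prefix_succ {w : ℕ → List ℕ} (hw : ∀ n, w n <+: w (n + 1))
    (hlen : ∀ n, n ≤ (w n).length) : ∃ p : Baire, ∀ n, p.Extends (w n) := by
  have hmono : ∀ m n, m ≤ n → w m <+: w n := by
    intro m n hmn
    induction n, hmn using Nat.le_induction with
    | base => exact List.prefix_rfl
    | succ n _ ih => exact ih.trans (hw n)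
  refine ⟨fun i => (w (i + 1)).getD i 0, fun n => ?_⟩
  refine List.IsPrefix.eq_of_length (word_prefix_iff.2 fun i hi => ?_) (by simp)
  have hi' : i < (w (i + 1)).length := hlen (i + 1)
  rcases le_total n (i + 1) with h | h
  · have h1 := (hmono _ _ h).getElem?_eq_some_of (List.getElem?_eq_getElem hi)
    simp [hi, h1]
  · have h1 := (hmono _ _ h).getElem?_eq_some_of (List.getElem?_eq_getElem hi')
    simp [hi', h1]

theorem exists_extends (w : List ℕ) : ∃ p : Baire, p.Extends w := by
  refine ⟨fun i => w.getD i 0, ?_⟩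
  refine List.IsPrefix.eq_of_length (word_prefix_iff.2 fun i hi => ?_) (by simp)
  simp [hi]

end Baire

/-! ### Forcing jump bits by limit computable searches -/

/-- `n` codes an extension `σ ++ v` of `σ`, a length `m` and a number `k` such that the `e`-th program
halts on the word `(σ ++ v).take m` within the bound `k`. -/
def extensionWitness (e : ℕ) (σ : List ℕ) (n : ℕ) : Bool :=
  (evaln (ofNat (List ℕ × ℕ × ℕ) n).2.2 (ofNat Code e)
    (encode ((σ ++ (ofNat (List ℕ × ℕ × ℕ) n).1).take (ofNat (List ℕ × ℕ × ℕ) n).2.1))).isSome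

theorem eval_dom_iff {c : Code} {x : ℕ} : (eval c x).Dom ↔ ∃ k, (evaln k c x).isSome := by
  simp only [Part.dom_iff_mem, Nat.Partrec.Code.evaln_complete, Option.isSome_iff_exists,
    Option.mem_def]
  exact exists_comm

theorem exists_extensionWitness {e : ℕ} {σ : List ℕ} :
    (∃ n, extensionWitness e σ n) ↔
      ∃ v m, (eval (ofNat Code e) (encode ((σ ++ v).take m))).Dom := by
  simp only [eval_dom_iff]
  constructor
  · rintro ⟨n, hn⟩
    exact ⟨_, _, _, hn⟩
  · rintro ⟨v, m, k, h⟩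
    refine ⟨encode (v, m, k), ?_⟩
    rw [extensionWitness, ofNat_encode]
    exact h

/-- The least witness below `t`. -/
def search (t e : ℕ) (σ : List ℕ) : Option ℕ :=
  Nat.rec none (fun n o => o <|> if extensionWitness e σ n then some n else none) t

open Classical in
/-- The least witness. -/
noncomputable def limitSearch (e : ℕ) (σ : List ℕ) : Option ℕ :=
  if h : ∃ n, extensionWitness e σ n then some (Nat.find h) else none

theorem search_succ (t e : ℕ) (σ : List ℕ) : search (t + 1) e σ =
    (search t e σ <|> if extensionWitness e σ t then some t else none) := rfl

theorem search_eq_none {t e : ℕ} {σ : List ℕ} (h : ∀ n < t, ¬ extensionWitness e σ n) :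
    search t e σ = none := by
  induction t with
  | zero => rfl
  | succ t ih =>
    rw [search_succ, ih fun n hn => h n (hn.trans t.lt_succ_self), if_neg (h t t.lt_succ_self)]
    rfl

/-- The first hit is never replaced, so the bounded search changes its answer at most once. -/
theorem eventually_search_eq (e : ℕ) (σ : List ℕ) :
    ∀ᶠ t in atTop, search t e σ = limitSearch e σ := by
  classical
  by_cases h : ∃ n, extensionWitness e σ n
  · refine eventually_atTop.2 ⟨Nat.find h + 1, fun t ht => ?_⟩
    rw [limitSearch, dif_pos h]
    induction t, ht using Nat.le_induction with
    | base =>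
      rw [search_succ, search_eq_none fun n hn => Nat.find_min h hn, if_pos (Nat.find_spec h)]
      rfl
    | succ t _ ih => rw [search_succ, ih]; rfl
  · refine Eventually.of_forall fun t => ?_
    rw [limitSearch, dif_neg h]
    exact search_eq_none fun n _ hn => h ⟨n, hn⟩

theorem isSome_limitSearch {e : ℕ} {σ : List ℕ} : (limitSearch e σ).isSome ↔
    ∃ v m, (eval (ofNat Code e) (encode ((σ ++ v).take m))).Dom := by
  classical
  rw [← exists_extensionWitness, limitSearch]
  split_ifs with h <;> simp [h]

/-- The extension of `σ` given by the witness found by `S`. -/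
def grow (S : ℕ → List ℕ → Option ℕ) (e : ℕ) (σ : List ℕ) : List ℕ :=
  σ ++ ((S e σ).map fun n => (ofNat (List ℕ × ℕ × ℕ) n).1).getD []

theorem prefix_grow (S : ℕ → List ℕ → Option ℕ) (e : ℕ) (σ : List ℕ) : σ <+: grow S e σ :=
  List.prefix_append _ _

theorem grow_congr {S T : ℕ → List ℕ → Option ℕ} {e : ℕ} {σ : List ℕ} (h : S e σ = T e σ) :
    grow S e σ = grow T e σ := by
  rw [grow, grow, h]

/-- If a witness exists, the grown word already has a prefix on which program `e` halts; if none
exists, no extension of `σ` lies in the open set. -/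
theorem mem_ceOpen_iff_of_extends_grow {e : ℕ} {σ : List ℕ} {p : Baire}
    (h : p.Extends (grow limitSearch e σ)) : p ∈ ceOpen e ↔ (limitSearch e σ).isSome := by
  classical
  constructor
  · rintro ⟨k, hk⟩
    -- The halting prefix may be shorter than `σ`, hence the maximum and the truncation to `k`.
    obtain ⟨v, hv⟩ := (h.mono (prefix_grow _ _ _)).word_eq_append (le_max_right k σ.length)
    refine isSome_limitSearch.2 ⟨v, k, ?_⟩
    rw [← hv, take_word, min_eq_left (le_max_left _ _)]
    exact hk
  · intro hs
    have hex : ∃ n, extensionWitness e σ n := by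
      by_contra hne
      simp [limitSearch, hne] at hs
    have hfind := Nat.find_spec hex
    have hgrow : grow limitSearch e σ = σ ++ (ofNat (List ℕ × ℕ × ℕ) (Nat.find hex)).1 := by
      simp [grow, limitSearch, hex]
    rw [extensionWitness, ← hgrow, ← h, take_word] at hfind
    exact ⟨_, eval_dom_iff.2 ⟨_, hfind⟩⟩

theorem isSome_limitSearch_nil {e : ℕ} : (limitSearch e []).isSome ↔ (ceOpen e).Nonempty := by
  constructor
  · intro h
    obtain ⟨p, hp⟩ := exists_extends (grow limitSearch e [])
    exact ⟨p, (mem_ceOpen_iff_of_extends_grow hp).2 h⟩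
  · rintro ⟨p, k, hk⟩
    exact isSome_limitSearch.2 ⟨p.word k, k, by simpa [take_word] using hk⟩

/-! ### The staged construction of the two points -/

/-- One stage of the construction: both words are extended so as to decide membership in the
`e`-th c.e. open set, and in between each of them records the length of the other one. The first
word also records whether the `e`-th c.e. open set is empty. -/
def jumpStep (S : ℕ → List ℕ → Option ℕ) (e : ℕ) (s : List ℕ × List ℕ) : List ℕ × List ℕ :=
  (grow S e s.1 ++ [Nat.pair (grow S e (s.2 ++ [(grow S e s.1).length])).length
    (S e []).isSome.toNat], grow S e (s.2 ++ [(grow S e s.1).length]))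

/-- The pair of words constructed after `n` stages. -/
def jumpStage (S : ℕ → List ℕ → Option ℕ) (n : ℕ) : List ℕ × List ℕ :=
  Nat.rec ([], []) (jumpStep S) n

theorem jumpStage_succ (S : ℕ → List ℕ → Option ℕ) (n : ℕ) :
    jumpStage S (n + 1) = jumpStep S n (jumpStage S n) := rfl

def leftJump (S : ℕ → List ℕ → Option ℕ) (e : ℕ) : ℕ :=
  (S e (jumpStage S e).1).isSome.toNat

def rightJump (S : ℕ → List ℕ → Option ℕ) (e : ℕ) : ℕ :=
  (S e ((jumpStage S e).2 ++ [(grow S e (jumpStage S e).1).length])).isSome.toNat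

/-- A stage consults finitely many searches, each of which stabilises. -/
theorem eventually_jumpStage_eq (n : ℕ) :
    ∀ᶠ t in atTop, jumpStage (search t) n = jumpStage limitSearch n := by
  induction n with
  | zero => exact Eventually.of_forall fun _ => rfl
  | succ n ih =>
    set s := jumpStage limitSearch n with hs
    filter_upwards [ih, eventually_search_eq n s.1, eventually_search_eq n [],
      eventually_search_eq n (s.2 ++ [(grow limitSearch n s.1).length])] with t h0 h1 h2 h3
    rw [jumpStage_succ, jumpStage_succ, h0, ← hs, jumpStep, jumpStep, grow_congr h1, h2,
      grow_congr h3]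

theorem eventually_leftJump_eq (e : ℕ) :
    ∀ᶠ t in atTop, leftJump (search t) e = leftJump limitSearch e := by
  filter_upwards [eventually_jumpStage_eq e,
    eventually_search_eq e (jumpStage limitSearch e).1] with t h0 h1
  rw [leftJump, leftJump, h0, h1]

theorem eventually_rightJump_eq (e : ℕ) :
    ∀ᶠ t in atTop, rightJump (search t) e = rightJump limitSearch e := by
  filter_upwards [eventually_jumpStage_eq e,
    eventually_search_eq e (jumpStage limitSearch e).1,
    eventually_search_eq e ((jumpStage limitSearch e).2 ++
      [(grow limitSearch e (jumpStage limitSearch e).1).length])] with t h0 h1 h2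
  rw [rightJump, rightJump, h0, grow_congr h1, h2]

/-! ### Primitive recursiveness of the approximations -/

section Primrec

theorem primrec_extensionWitness :
    Primrec fun a : (ℕ × List ℕ) × ℕ => extensionWitness a.1.1 a.1.2 a.2 := by
  have hn : Primrec fun a : (ℕ × List ℕ) × ℕ => ofNat (List ℕ × ℕ × ℕ) a.2 :=
    (Primrec.ofNat _).comp Primrec.snd
  have hc : Primrec fun a : (ℕ × List ℕ) × ℕ => ofNat Code a.1.1 :=
    (Primrec.ofNat _).comp (Primrec.fst.comp Primrec.fst)
  have hw := Primrec.encode.comp (Primrec.list_take.comp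
    (Primrec.fst.comp (Primrec.snd.comp hn))
    (Primrec.list_append.comp (Primrec.snd.comp Primrec.fst) (Primrec.fst.comp hn)))
  exact Primrec.option_isSome.comp (Nat.Partrec.Code.primrec_evaln.comp
    (((Primrec.snd.comp (Primrec.snd.comp hn)).pair hc).pair hw))

theorem primrec_search : Primrec fun a : ℕ × ℕ × List ℕ => search a.1 a.2.1 a.2.2 := by
  refine Primrec.nat_rec' Primrec.fst (Primrec.const none)
    (h := fun (a : ℕ × ℕ × List ℕ) (b : ℕ × Option ℕ) => b.2 <|> if extensionWitness a.2.1 a.2.2 b.1 then some b.1 else none) ?_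
  refine (Primrec.option_orElse.comp (Primrec.snd.comp Primrec.snd) (Primrec.ite
    (Primrec.eq.comp (primrec_extensionWitness.comp ((Primrec.snd.comp Primrec.fst).pair
      (Primrec.fst.comp Primrec.snd))) (Primrec.const true))
    (Primrec.option_some.comp (Primrec.fst.comp Primrec.snd)) (Primrec.const none))).to₂

variable {α : Type*} [Primcodable α] {t e : α → ℕ} {σ : α → List ℕ} {s : α → List ℕ × List ℕ}

theorem Primrec.search_comp (ht : Primrec t) (he : Primrec e) (hσ : Primrec σ) :
    Primrec fun a => search (t a) (e a) (σ a) :=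
  primrec_search.comp (ht.pair (he.pair hσ))

theorem Primrec.isSome_toNat_search (ht : Primrec t) (he : Primrec e) (hσ : Primrec σ) :
    Primrec fun a => (search (t a) (e a) (σ a)).isSome.toNat :=
  (Primrec.dom_bool Bool.toNat).comp (Primrec.option_isSome.comp (Primrec.search_comp ht he hσ))

theorem Primrec.grow_search (ht : Primrec t) (he : Primrec e) (hσ : Primrec σ) :
    Primrec fun a => grow (search (t a)) (e a) (σ a) :=
  Primrec.list_append.comp hσ (Primrec.option_getD.comp
    (Primrec.option_map (Primrec.search_comp ht he hσ)
      ((Primrec.fst.comp ((Primrec.ofNat (List ℕ × ℕ × ℕ)).comp Primrec.snd)).to₂)) (Primrec.const []))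

theorem Primrec.append_length_grow_search (ht : Primrec t) (he : Primrec e) (hs : Primrec s) :
    Primrec fun a => (s a).2 ++ [(grow (search (t a)) (e a) (s a).1).length] :=
  Primrec.list_concat.comp (Primrec.snd.comp hs)
    (Primrec.list_length.comp (Primrec.grow_search ht he (Primrec.fst.comp hs)))

theorem Primrec.jumpStep_search (ht : Primrec t) (he : Primrec e) (hs : Primrec s) :
    Primrec fun a => jumpStep (search (t a)) (e a) (s a) := by
  have hr := Primrec.grow_search ht he (Primrec.append_length_grow_search ht he hs)
  exact (Primrec.list_concat.comp (Primrec.grow_search ht he (Primrec.fst.comp hs))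
    (Primrec₂.natPair.comp (Primrec.list_length.comp hr)
      (Primrec.isSome_toNat_search ht he (Primrec.const [])))).pair hr

theorem Primrec.jumpStage_search (ht : Primrec t) (he : Primrec e) :
    Primrec fun a => jumpStage (search (t a)) (e a) :=
  Primrec.nat_rec' he (Primrec.const ([], []))
    (Primrec.jumpStep_search (ht.comp Primrec.fst) (Primrec.fst.comp Primrec.snd)
      (Primrec.snd.comp Primrec.snd)).to₂

theorem Primrec.leftJump_search (ht : Primrec t) (he : Primrec e) :
    Primrec fun a => leftJump (search (t a)) (e a) :=
  Primrec.isSome_toNat_search ht he (Primrec.fst.comp (Primrec.jumpStage_search ht he))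

theorem Primrec.rightJump_search (ht : Primrec t) (he : Primrec e) :
    Primrec fun a => rightJump (search (t a)) (e a) :=
  Primrec.isSome_toNat_search ht he
    (Primrec.append_length_grow_search ht he (Primrec.jumpStage_search ht he))

end Primrec

/-! ### Two low points that jointly compute the halting problem -/

theorem turingJump_eq_isSome_toNat {e : ℕ} {σ : List ℕ} {p : Baire}
    (h : p.Extends (grow limitSearch e σ)) :
    turingJump p e = (limitSearch e σ).isSome.toNat := by
  have := mem_ceOpen_iff_of_extends_grow h
  cases hb : (limitSearch e σ).isSome
  · exact turingJump_eq_zero.2 (by simp [this, hb])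
  · exact turingJump_eq_one.2 (by simp [this, hb])

/-- There are two points with limit computable Turing jump that jointly compute the halting
problem: the values `V e` encode the answers and can be read off from both points in turn. -/
theorem exists_low_pair : ∃ p q x y : Baire, Computable x ∧ Computable y ∧ p ∈ lowMap x ∧
    q ∈ lowMap y ∧ ∃ V : ℕ → ℕ, V 0 = 0 ∧ ∀ e, V (e + 1) = p (q (V e).unpair.1) ∧
      ((V (e + 1)).unpair.2 = 0 ↔ ceOpen e = ∅) := by
  set s := jumpStage limitSearch with hs
  have h1 : ∀ n, grow limitSearch n (s n).1 <+: (s (n + 1)).1 := fun n => List.prefix_append _ _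
  have h2 : ∀ n, (s n).2 ++ [(grow limitSearch n (s n).1).length] <+: (s (n + 1)).2 :=
    fun n => prefix_grow _ _ _
  obtain ⟨p, hp⟩ := exists_extends_of_prefix_succ (w := fun n => (s n).1)
    (fun n => (prefix_grow _ _ _).trans (h1 n)) (fun n => by
      induction n with
      | zero => exact Nat.zero_le _
      | succ n ih =>
        have := (prefix_grow limitSearch n (s n).1).length_le
        simp only [hs, jumpStage_succ, jumpStep, List.length_append, List.length_singleton] at *
        omega)
  obtain ⟨q, hq⟩ := exists_extends_of_prefix_succ (w := fun n => (s n).2)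
    (fun n => (List.prefix_append _ _).trans (h2 n)) (fun n => by
      induction n with
      | zero => exact Nat.zero_le _
      | succ n ih =>
        have := (h2 n).length_le
        simp only [List.length_append, List.length_singleton] at *
        omega)
  refine ⟨p, q, fun n => leftJump (search n.unpair.1) n.unpair.2,
    fun n => rightJump (search n.unpair.1) n.unpair.2,
    (Primrec.leftJump_search (Primrec.fst.comp Primrec.unpair)
      (Primrec.snd.comp Primrec.unpair)).to_comp,
    (Primrec.rightJump_search (Primrec.fst.comp Primrec.unpair)
      (Primrec.snd.comp Primrec.unpair)).to_comp,
    mem_lowMap.2 fun e => ?_, mem_lowMap.2 fun e => ?_,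
    -- `V e` holds the length of the second word at stage `e`, where `q` stores the position of the
    -- next record in `p`. The start 0 codes the pair `(0, 0)`, matching the empty word.
    fun n => Nat.rec 0 (fun e _ => Nat.pair (s (e + 1)).2.length (limitSearch e []).isSome.toNat) n,
    rfl, fun e => ⟨?_, ?_⟩⟩
  · simp only [Nat.unpair_pair, turingJump_eq_isSome_toNat ((hp (e + 1)).mono (h1 e))]
    exact eventually_leftJump_eq e
  · simp only [Nat.unpair_pair, turingJump_eq_isSome_toNat (hq (e + 1))]
    exact eventually_rightJump_eq e
  · have hV : ∀ e, (Nat.unpair (Nat.rec 0 (fun e _ => Nat.pair (s (e + 1)).2.length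
        (limitSearch e []).isSome.toNat) e : ℕ)).1 = (s e).2.length := by
      rintro (_ | e)
      · simp [hs, jumpStage]
      · simp
    rw [hV, ((hq (e + 1)).mono (h2 e)).apply_length]
    exact (hp (e + 1)).apply_length.symm
  · have := isSome_limitSearch_nil (e := e)
    rw [← Set.not_nonempty_iff_eq_empty, ← this]
    simp only [Nat.unpair_pair]
    cases (limitSearch e []).isSome <;> decide

/-! ### Diagonalisation against low points -/

/-- A point with limit computable Turing jump cannot enumerate the indices of the empty c.e. open
sets. -/
theorem not_enumerates_empty {r z : Baire} (hz : Computable z) (hr : r ∈ lowMap z)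
    {A : List ℕ → ℕ → Bool} (hA : Computable₂ A)
    (h : ∀ e, (∃ k, A (r.word k) e) ↔ ceOpen e = ∅) : False := by
  have hf : Computable fun n : ℕ => if z (Nat.pair (n.unpair.1.unpair.2 + n.unpair.2)
      n.unpair.1.unpair.1) ≠ 0 then some 0 else none := by
    have hp : Primrec fun n : ℕ => n.unpair.1.unpair := Primrec.unpair.comp
      (Primrec.fst.comp Primrec.unpair)
    have hi : Primrec fun n : ℕ => Nat.pair (n.unpair.1.unpair.2 + n.unpair.2)
        n.unpair.1.unpair.1 :=
      Primrec₂.natPair.comp (Primrec.nat_add.comp (Primrec.snd.comp hp)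
        (Primrec.snd.comp Primrec.unpair)) (Primrec.fst.comp hp)
    have ho : Primrec fun n : ℕ => if n ≠ 0 then some 0 else none :=
      Primrec.ite (Primrec.eq.comp Primrec.id (Primrec.const 0)).not (Primrec.const (some 0))
        (Primrec.const none)
    exact ho.to_comp.comp (hz.comp hi.to_comp)
  obtain ⟨d, hd⟩ := Partrec.exists_code hf
  -- The set with index `g c i` is empty exactly when the approximation to jump bit `c` is 0 from
  -- time `i` on.
  let g : ℕ → ℕ → ℕ := fun c i => encode (d.curry (Nat.pair c i))
  have hg : Primrec₂ g := Primrec.encode.comp₂ (Nat.Partrec.Code.primrec₂_curry.comp₂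
    (Primrec₂.const d) Primrec₂.natPair)
  have hempty : ∀ c i, ceOpen (g c i) = ∅ ↔ ∀ j, z (Nat.pair (i + j) c) = 0 := by
    intro c i
    have hmem : ∀ p : Baire, p ∈ ceOpen (g c i) ↔
        ∃ k, z (Nat.pair (i + encode (p.word k)) c) ≠ 0 := by
      intro p
      rw [mem_ceOpen]
      refine exists_congr fun k => ?_
      simp only [g, ofNat_encode, Nat.Partrec.Code.eval_curry, hd, Nat.unpair_pair]
      split_ifs with h0 <;> simp [h0]
    rw [Set.eq_empty_iff_forall_notMem]
    constructor
    · intro hp j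
      -- Every `j` codes a word, and every word begins some sequence, so all times from `i` on are
      -- tested.
      obtain ⟨p, hp'⟩ := exists_extends (ofNat (List ℕ) j)
      by_contra hne
      refine hp p ((hmem p).2 ⟨(ofNat (List ℕ) j).length, ?_⟩)
      rwa [hp', Denumerable.encode_ofNat]
    · rintro hj p hp
      obtain ⟨k, hk⟩ := (hmem p).1 hp
      exact hk (hj _)
  have hpart : Partrec₂ fun (c : Code) (x : ℕ) =>
      Nat.rfind fun i => (Part.some (A (ofNat (List ℕ) x) (g (encode c) i)) : Part Bool) := by
    have hc : Computable fun y : (Code × ℕ) × ℕ =>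
        A (ofNat (List ℕ) y.1.2) (g (encode y.1.1) y.2) :=
      hA.comp ((Computable.ofNat _).comp (Computable.snd.comp Computable.fst))
        (hg.to_comp.comp (Computable.encode.comp (Computable.fst.comp Computable.fst))
          Computable.snd)
    exact Partrec.rfind hc.partrec.to₂
  -- Program `c` halts once `A` confirms, for some `i`, that the approximation to bit `c` itself
  -- stays 0 from `i` on.
  obtain ⟨c, hc⟩ := Nat.Partrec.Code.fixed_point₂ hpart
  have hiff : r ∈ ceOpen (encode c) ↔ turingJump r (encode c) = 0 := by
    have h1 : r ∈ ceOpen (encode c) ↔ ∃ k i, A (r.word k) (g (encode c) i) := by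
      rw [mem_ceOpen]
      refine exists_congr fun k => ?_
      rw [ofNat_encode, hc]
      refine Nat.rfind_dom'.trans ?_
      simp [eq_comm (a := true)]
    rw [h1, exists_comm]
    simp only [h, hempty]
    have hlim := mem_lowMap.1 hr (encode c)
    constructor
    · rintro ⟨i, hi⟩
      obtain ⟨t, ht, hti⟩ := (hlim.and (eventually_ge_atTop i)).exists
      rw [← ht, ← Nat.add_sub_of_le hti]
      exact hi _
    · intro h0
      obtain ⟨i, hi⟩ := eventually_atTop.1 hlim
      exact ⟨i, fun j => (hi _ (Nat.le_add_right i j)).trans h0⟩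
  rw [turingJump_eq_zero] at hiff
  exact (iff_not_self hiff)

/-! ### Decoding from finite parts of a pair -/

/-- A finite part of the pairing of two sequences. -/
def interleave (u v : List ℕ) : List ℕ :=
  (List.range (2 * v.length)).map fun i => if i % 2 = 0 then u.getD (i / 2) 0 else v.getD (i / 2) 0

theorem interleave_word (p q : Baire) (k : ℕ) :
    interleave (p.word k) (q.word k) = (Baire.pair p q).word (2 * k) := by
  rw [interleave, length_word, Baire.word]
  refine List.map_congr_left fun i hi => ?_
  have hi2 : i / 2 < k := by
    rw [List.mem_range] at hi
    omega
  simp [hi2, Baire.pair]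

theorem primrec₂_interleave : Primrec₂ interleave := by
  refine Primrec.list_map (Primrec.list_range.comp
    (Primrec.nat_mul.comp (Primrec.const 2) (Primrec.list_length.comp Primrec.snd))) ?_
  have hdiv : Primrec fun a : (List ℕ × List ℕ) × ℕ => a.2 / 2 :=
    Primrec.nat_div.comp Primrec.snd (Primrec.const 2)
  exact (Primrec.ite (Primrec.eq.comp (Primrec.nat_mod.comp Primrec.snd (Primrec.const 2))
    (Primrec.const 0))
    ((Primrec.list_getD 0).comp (Primrec.fst.comp Primrec.fst) hdiv)
    ((Primrec.list_getD 0).comp (Primrec.snd.comp Primrec.fst) hdiv)).to₂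

/-- Iteration of `v ↦ p (q v.unpair.1)` starting from `0`, where `u` is a finite part of the
pairing of `p` and `q`. -/
def readAlternately (u : List ℕ) (e : ℕ) : Option ℕ :=
  Nat.rec (some 0)
    (fun _ o => o.bind fun v => (u[2 * v.unpair.1 + 1]?).bind fun a => u[2 * a]?) e

theorem readAlternately_succ (u : List ℕ) (e : ℕ) : readAlternately u (e + 1) =
    (readAlternately u e).bind fun v => (u[2 * v.unpair.1 + 1]?).bind fun a => u[2 * a]? := rfl

theorem primrec₂_readAlternately : Primrec₂ readAlternately := by
  refine Primrec.nat_rec' Primrec.snd (Primrec.const (some 0)) (h := fun (a : List ℕ × ℕ) (b : ℕ × Option ℕ) =>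
    b.2.bind fun v => (a.1[2 * v.unpair.1 + 1]?).bind fun a' => a.1[2 * a']?) ?_
  have h : Primrec₂ fun (b : ((List ℕ × ℕ) × (ℕ × Option ℕ)) × ℕ) (a : ℕ) => b.1.1.1[2 * a]? :=
    (Primrec.list_getElem?.comp
      (Primrec.fst.comp (Primrec.fst.comp (Primrec.fst.comp Primrec.fst)))
      (Primrec.nat_double.comp Primrec.snd)).to₂
  have h' : Primrec₂ fun (b : (List ℕ × ℕ) × (ℕ × Option ℕ)) (v : ℕ) =>
      (b.1.1[2 * v.unpair.1 + 1]?).bind fun a => b.1.1[2 * a]? :=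
    (Primrec.option_bind (Primrec.list_getElem?.comp
      (Primrec.fst.comp (Primrec.fst.comp Primrec.fst)) (Primrec.nat_double_succ.comp
        (Primrec.fst.comp (Primrec.unpair.comp Primrec.snd)))) h).to₂
  exact (Primrec.option_bind (Primrec.snd.comp Primrec.snd) h').to₂

section readAlternately

variable {p q : Baire} {V : ℕ → ℕ}

theorem readAlternately_eq_some (h0 : V 0 = 0)
    (hV : ∀ e, V (e + 1) = p (q (V e).unpair.1)) {u : List ℕ}
    (hu : ∀ i a, u[i]? = some a → a = Baire.pair p q i) {e v : ℕ}
    (h : readAlternately u e = some v) : v = V e := by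
  have hl : ∀ i a, u[2 * i]? = some a → a = p i := fun i a ha =>
    (hu _ _ ha).trans (congrFun (left_pair p q) i)
  have hr : ∀ i a, u[2 * i + 1]? = some a → a = q i := fun i a ha =>
    (hu _ _ ha).trans (congrFun (right_pair p q) i)
  induction e generalizing v with
  | zero => rw [h0]; exact (Option.some.inj h).symm
  | succ e ih =>
    rw [readAlternately_succ] at h
    obtain ⟨w, hw, h⟩ := Option.bind_eq_some_iff.1 h
    obtain ⟨a, ha, h⟩ := Option.bind_eq_some_iff.1 h
    rw [hV, ← ih hw, ← hr _ _ ha]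
    exact hl _ _ h

theorem exists_readAlternately_eq (h0 : V 0 = 0)
    (hV : ∀ e, V (e + 1) = p (q (V e).unpair.1)) (e : ℕ) :
    ∃ k, ∀ u, (Baire.pair p q).word k <+: u → readAlternately u e = some (V e) := by
  induction e with
  | zero => exact ⟨0, fun u _ => by rw [h0]; rfl⟩
  | succ e ih =>
    obtain ⟨k, hk⟩ := ih
    -- The prefix must reach past the odd position read for `q` and the even position read for `p`.
    refine ⟨max k (max (2 * (V e).unpair.1 + 2) (2 * q (V e).unpair.1 + 1)), fun u hu => ?_⟩
    have hu' := word_prefix_iff.1 hu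
    rw [readAlternately_succ, hk u ((word_prefix_word _ (le_max_left _ _)).trans hu),
      Option.bind_some, hu' _ (by omega)]
    have h1 : Baire.pair p q (2 * (V e).unpair.1 + 1) = q (V e).unpair.1 :=
      congrFun (right_pair p q) _
    rw [Option.bind_some, h1, hu' _ (by omega), hV]
    exact congrArg some (congrFun (left_pair p q) _)

end readAlternately

/-! ### The product does not reduce to the low map -/

theorem not_prod_lowMap_le : ¬ WeihrauchReducible (lowMap.prod lowMap) lowMap := by
  classical
  rintro ⟨K, H, hK, hH, hred⟩
  obtain ⟨p, q, x, y, hx, hy, hpx, hqy, V, h0, hV⟩ := exists_low_pair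
  let G : Baire →. Baire := fun z => ⟨(lowMap z).Nonempty, fun h => h.some⟩
  have hG : Realizes G lowMap := by
    intro z z' hz hdom
    obtain rfl := mem_rep.1 hz
    exact ⟨_, ⟨hdom, rfl⟩, _, mem_rep.2 rfl, hdom.some_mem⟩
  set s := Baire.pair x y with hs_def
  have hs : Computable s := by
    have hdiv : Computable fun n : ℕ => n / 2 :=
      (Primrec.nat_div.comp Primrec.id (Primrec.const 2)).to_comp
    have hmod : Computable fun n : ℕ => decide (n % 2 = 0) :=
      (Primrec.eq.comp (Primrec.nat_mod.comp Primrec.id (Primrec.const 2))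
        (Primrec.const 0)).decide.to_comp
    refine (Computable.cond hmod (hx.comp hdiv) (hy.comp hdiv)).of_eq fun n => ?_
    by_cases h : n % 2 = 0 <;> simp [hs_def, Baire.pair, h]
  obtain ⟨o, ho, ⟨y1, y2⟩, hy12, hy1, hy2⟩ := hred G hG s (x, y)
    (mem_rep_prod.2 ⟨(left_pair _ _).symm, (right_pair _ _).symm⟩) ⟨(p, q), hpx, hqy⟩
  obtain ⟨rfl, rfl⟩ := mem_rep_prod.1 hy12
  -- `lowMap` is single-valued, so the output can only be this pair.
  have hop : o = Baire.pair p q := by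
    rw [← lowMap_subsingleton hy1 hpx, ← lowMap_subsingleton hy2 hqy]
    exact (pair_left_right o).symm
  obtain ⟨sr, hsr, hoK⟩ := Part.mem_bind_iff.1 ho
  obtain ⟨r, hr, rfl⟩ := (Part.mem_map_iff _).1 hsr
  obtain ⟨z, hz, hGz⟩ := Part.mem_bind_iff.1 hr
  obtain ⟨hdom, hsome⟩ := hGz
  have hrz : r ∈ lowMap z := hsome ▸ Set.Nonempty.some_mem hdom
  have hzc : Computable z := hH.computable hs hz
  obtain ⟨φ, hφ, hmono, hout⟩ := hK
  have hout := hout _ _ hoK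
  subst hop
  -- `s` is computable, so a prefix of `r` alone suffices to run the machine for `K`. The default
  -- `false` covers outputs still too short to decode; only confirmed emptiness counts.
  refine not_enumerates_empty hzc hrz
    (A := fun w e => ((readAlternately (φ (interleave (s.word w.length) w)) (e + 1)).map
      fun v => decide (v.unpair.2 = 0)).getD false) ?_ fun e => ?_
  · have h1 : Computable fun a : List ℕ × ℕ => φ (interleave (s.word a.1.length) a.1) :=
      hφ.comp (primrec₂_interleave.to_comp.comp
        (hs.baire_word.comp (Computable.list_length.comp Computable.fst)) Computable.fst)
    have h2 : Primrec₂ fun (_ : List ℕ × ℕ) (v : ℕ) => decide (v.unpair.2 = 0) :=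
      ((Primrec.eq.comp (Primrec.snd.comp (Primrec.unpair.comp Primrec.snd))
        (Primrec.const 0)).decide).to₂
    exact Computable.option_getD (Computable.option_map (primrec₂_readAlternately.to_comp.comp h1
      (Computable.succ.comp Computable.snd)) h2.to_comp) (Computable.const false)
  · rw [← (hV e).2]
    have hV' := fun e => (hV e).1
    simp only [length_word, interleave_word]
    constructor
    · rintro ⟨k, hk⟩
      cases hd : readAlternately (φ ((Baire.pair s r).word (2 * k))) (e + 1) with
      | none => simp [hd] at hk
      | some v =>
        rw [← readAlternately_eq_some h0 hV'
          (fun i a => BaireComputable.getElem?_eq hmono hout) hd]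
        simpa [hd] using hk
    · intro hVe
      obtain ⟨k, hk⟩ := exists_readAlternately_eq h0 hV' (e + 1)
      obtain ⟨n, hn⟩ := hout k
      refine ⟨n, ?_⟩
      rw [hk _ (hn.trans (hmono _ _ (word_prefix_word _ (by omega))))]
      simp [hVe]

theorem mainTheorem10 :
    StrictlyWeihrauchReducible lowMap (lowMap.prod lowMap) ∧ ¬ WeihrauchIdempotent lowMap :=
  ⟨⟨lowMap_le_prod, not_prod_lowMap_le⟩, fun h => not_prod_lowMap_le h.1⟩
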